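/- Let $E$ be a (real) Banach lattice. A sequence $(x_n)_{n\ge 1}$ in $E$ is called normalized disjoint if $\|x_n\|=1$ for every $n$ and $|x_m|\wedge|x_n|=0$ whenever $m\neq n$. Two sequences $(x_n)$ and $(y_n)$ in $E$ are called equivalent, written $(x_n)\sim(y_n)$, if there is a constant $C>0$ such that for every sequence of real scalars $(a_n)_{n\ge1}$ the series $\sum_{n} a_n x_n$ converges in norm if and only if $\sum_n a_n y_n$ does, and in that case $$C^{-1}\Bigl\|\sum_{n=1}^\infty a_n y_n\Bigr\|\le\Bigl\|\sum_{n=1}^\infty a_n x_n\Bigr\|\le C\Bigl\|\sum_{n=1}^\infty a_n y_n\Bigr\|.$$ The Banach lattice $E$ is called disjointly homogeneous (DH) if for every pair $(x_n)$, $(y_n)$ of normalized disjoint sequences in $E$ there is a strictly increasing sequence of indices $(n_k)$ such that $(x_{n_k})\sim(y_{n_k})$. It is called quasi-DH if for every pair $(x_n)$, $(y_n)$ of normalized disjoint sequences in $E$ there are strictly increasing sequences of indices $(n_k)$ and $(m_k)$, not necessarily equal, such that $(x_{n_k})\sim(y_{m_k})$. Then $E$ is disjointly homogeneous if and only if it is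 quasi-DH. -/

import Mathlib

open Filter Topology

namespace BanachLattice

section Sequences

variable {E F : Type*} [NormedAddCommGroup E] [NormedSpace ℝ E]
  [NormedAddCommGroup F] [NormedSpace ℝ F]

/-- The series `∑ aₙ xₙ` converges in norm to `s` (convergence of the ordered partial sums). -/
def SeriesConvergesTo (a : ℕ → ℝ) (x : ℕ → E) (s : E) : Prop :=
  Tendsto (fun N => ∑ n ∈ Finset.range N, a n • x n) atTop (𝓝 s)

/-- `(xₙ)` and `(yₙ)` are `C`-equivalent: for every scalar sequence `(aₙ)` the series `∑ aₙ xₙ`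
converges if and only if `∑ aₙ yₙ` converges, and when they converge
`C⁻¹ ‖∑ aₙ yₙ‖ ≤ ‖∑ aₙ xₙ‖ ≤ C ‖∑ aₙ yₙ‖`. -/
def EquivWith (C : ℝ) (x : ℕ → E) (y : ℕ → F) : Prop :=
  ∀ a : ℕ → ℝ,
    ((∃ s, SeriesConvergesTo a x s) ↔ ∃ t, SeriesConvergesTo a y t) ∧
    ∀ s t, SeriesConvergesTo a x s → SeriesConvergesTo a y t →
      C⁻¹ * ‖t‖ ≤ ‖s‖ ∧ ‖s‖ ≤ C * ‖t‖

/-- Equivalence of sequences: `C`-equivalence for some constant `C > 0`. -/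
def SeqEquiv (x : ℕ → E) (y : ℕ → F) : Prop :=
  ∃ C : ℝ, 0 < C ∧ EquivWith C x y

end Sequences

section Lattices

/-- A normalized disjoint sequence: `‖xₙ‖ = 1` for all `n`, and `|xₘ| ∧ |xₙ| = 0` for `m ≠ n`. -/
def IsNormalizedDisjoint {E : Type*} [NormedAddCommGroup E] [Lattice E] (x : ℕ → E) : Prop :=
  (∀ n, ‖x n‖ = 1) ∧ ∀ m n, m ≠ n → |x m| ⊓ |x n| = 0

/-- Disjointly homogeneous: any two normalized disjoint sequences have equivalent subsequences
taken along the same index sequence. -/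
def IsDH (E : Type*) [NormedAddCommGroup E] [NormedSpace ℝ E] [Lattice E] : Prop :=
  ∀ x y : ℕ → E, IsNormalizedDisjoint x → IsNormalizedDisjoint y →
    ∃ n : ℕ → ℕ, StrictMono n ∧ SeqEquiv (x ∘ n) (y ∘ n)

/-- Quasi-DH: any two normalized disjoint sequences have equivalent subsequences, possibly taken
along different index sequences. -/
def IsQuasiDH (E : Type*) [NormedAddCommGroup E] [NormedSpace ℝ E] [Lattice E] : Prop :=
  ∀ x y : ℕ → E, IsNormalizedDisjoint x → IsNormalizedDisjoint y →
    ∃ n m : ℕ → ℕ, StrictMono n ∧ StrictMono m ∧ SeqEquiv (x ∘ n) (y ∘ m)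

end Lattices

end BanachLattice

namespace BanachLattice

/-! ### Ramsey dichotomies along an ultrafilter. -/

section Ramsey

/-! Only quasi-DH implies DH needs work, and it is Ramsey theory: disjointness matters only because
it passes to subsequences. Colour an index sequence by whether `x` along its even terms is
equivalent to `y` along its odd terms. Equivalence with a fixed constant is a closed condition, so
`exists_forall_subseq_or_forall_not` makes the colour constant on all subsequences of some sequence.
If it is "equivalent", comparing three interlaced pairs yields equivalence along common indices
(`exists_seqEquiv_subseq_or_forall_interlaced_not`). Otherwise assume the negative colour for both
`(x, y)` and `(y, x)`. Quasi-DH still gives equivalent subsequences along some `p` and `q`.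
Infinitely often `p k < q k` or `q k < p k`, which after thinning contradicts a negative colour, or
`p k = q k`, which gives common indices. -/

/-- The list of the first `k` terms of a sequence. -/
def initialTerms (n : ℕ → ℕ) (k : ℕ) : List ℕ := (List.range k).map n

@[simp] theorem initialTerms_zero (n : ℕ → ℕ) : initialTerms n 0 = [] := rfl

theorem initialTerms_succ (n : ℕ → ℕ) (k : ℕ) :
    initialTerms n (k + 1) = initialTerms n k ++ [n k] := by
  simp [initialTerms, List.range_succ]

theorem initialTerms_succ' (n : ℕ → ℕ) (k : ℕ) :
    initialTerms n (k + 1) = n 0 :: initialTerms (fun i => n (i + 1)) k := by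
  simp [initialTerms, List.range_succ_eq_map, Function.comp_def]

@[simp] theorem length_initialTerms (n : ℕ → ℕ) (k : ℕ) : (initialTerms n k).length = k := by
  simp [initialTerms]

theorem eq_of_initialTerms_eq {n n' : ℕ → ℕ} {k k' : ℕ}
    (h : initialTerms n k = initialTerms n' k') : k = k' ∧ ∀ i < k, n i = n' i := by
  have hk : k = k' := by simpa using congrArg List.length h
  subst hk
  refine ⟨rfl, fun i hi => ?_⟩
  simpa [initialTerms] using List.map_inj_left.1 h i (List.mem_range.2 hi)

/-- The sequence `n` follows the tree `A`: each term lies in the set that `A` assigns to the list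
of the preceding terms. -/
def Follows (n : ℕ → ℕ) (A : List ℕ → Set ℕ) : Prop := ∀ k, n k ∈ A (initialTerms n k)

/-- The lists from which the family `F` is reached along some `U`-branching well-founded tree. -/
inductive Reaches (U : Filter ℕ) (F : Set (List ℕ)) : List ℕ → Prop
  | base {s : List ℕ} : s ∈ F → Reaches U F s
  | step {s : List ℕ} (S : Set ℕ) : S ∈ U → (∀ n ∈ S, Reaches U F (s ++ [n])) → Reaches U F s

theorem Reaches.exists_tree {U : Filter ℕ} {F : Set (List ℕ)} {s : List ℕ}
    (h : Reaches U F s) : ∃ A : List ℕ → Set ℕ, (∀ t, A t ∈ U) ∧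
      ∀ n, Follows n A → ∃ k, s ++ initialTerms n k ∈ F := by
  induction h with
  | base hs => exact ⟨fun _ => Set.univ, fun _ => univ_mem, fun _ _ => ⟨0, by simpa using hs⟩⟩
  | @step s S hS _ ih =>
    classical
    choose! B hBU hB using ih
    -- Glue the subtrees `B n` below a root with successor set `S`; the default `Set.univ` keeps
    -- every value in `U`.
    refine ⟨fun t => t.rec S fun n t _ => if n ∈ S then B n t else Set.univ, ?_, ?_⟩
    · rintro (_ | ⟨n, t⟩)
      · exact hS
      · by_cases hn : n ∈ S
        · simpa [hn] using hBU n hn t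
        · simp [hn]
    · intro n hn
      have h0 : n 0 ∈ S := hn 0
      obtain ⟨k, hk⟩ := hB (n 0) h0 (fun i => n (i + 1)) fun k => by
        have := hn (k + 1)
        rw [initialTerms_succ'] at this
        simpa [h0] using this
      refine ⟨k + 1, ?_⟩
      rw [initialTerms_succ']
      simpa using hk

/-- Ramsey property of open sets of sequences, in terms of trees branching along an ultrafilter. -/
theorem exists_tree_avoids_or_meets (U : Ultrafilter ℕ) (F : Set (List ℕ)) :
    (∃ A : List ℕ → Set ℕ, (∀ t, A t ∈ U) ∧ ∀ n, Follows n A → ∀ k, initialTerms n k ∉ F) ∨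
    (∃ A : List ℕ → Set ℕ, (∀ t, A t ∈ U) ∧ ∀ n, Follows n A → ∃ k, initialTerms n k ∈ F) := by
  by_cases h : Reaches U F []
  · exact Or.inr (by simpa using h.exists_tree)
  · left
    -- Stay at nodes that do not reach `F`: if `U`-many successors reached it, so would the node,
    -- hence the remaining successors form a set in the ultrafilter.
    refine ⟨fun t => {n | ¬ Reaches U F t → ¬ Reaches U F (t ++ [n])}, fun t => ?_, ?_⟩
    · by_cases ht : Reaches U F t
      · simp only [ht, not_true_eq_false, false_imp_iff]
        exact univ_mem
      · have : {n | Reaches U F (t ++ [n])} ∉ U := fun hm => ht (.step _ hm fun _ hn => hn)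
        simpa [ht, Set.compl_def] using Ultrafilter.compl_mem_iff_notMem.2 this
    · intro n hn k hk
      have key : ∀ k, ¬ Reaches U F (initialTerms n k) := fun k => by
        induction k with
        | zero => exact h
        | succ k ih =>
          rw [initialTerms_succ]
          exact hn k ih
      exact key k (.base hk)

/-- Diagonalization: some sequence has all its subsequences following given trees, up to finitely
many terms. -/
theorem exists_strictMono_follows {U : Filter ℕ} [NeBot U] (hU : U ≤ atTop)
    (A : ℕ → List ℕ → Set ℕ) (hA : ∀ K t, A K t ∈ U) :
    ∃ m : ℕ → ℕ, StrictMono m ∧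
      ∀ K (φ : ℕ → ℕ), StrictMono φ → K ≤ φ 0 → Follows (m ∘ φ) (A K) := by
  let L : ℕ → Set (List ℕ) := fun q => {t | t.length ≤ q ∧ ∀ i ∈ t, i < q}
  have hL : ∀ q, (L q).Finite := fun q => by
    refine ((List.finite_length_le (Fin q) q).image (List.map Fin.val)).subset ?_
    rintro t ⟨h1, h2⟩
    exact ⟨t.pmap Fin.mk h2, by simpa using h1, by simp [List.map_pmap]⟩
  -- Only finitely many lists have length and entries bounded by `q`, so one set in `U` meets all
  -- their constraints for `K ≤ q`.
  let D : ℕ → Set ℕ := fun q => ⋂ K ∈ Set.Iic q, ⋂ t ∈ L q, A K t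
  have hD : ∀ q, D q ∈ U := fun q =>
    (biInter_mem (Set.finite_Iic q)).2 fun K _ => (biInter_mem (hL q)).2 fun t _ => hA K t
  have hex : ∀ q, ∃ p, q ≤ p ∧ p ∈ D q := fun q =>
    nonempty_of_mem (inter_mem (hU (Ici_mem_atTop q)) (hD q))
  choose f hf hfD using hex
  let m : ℕ → ℕ := fun j => Nat.rec (f 0) (fun _ r => f (r + 1)) j
  have hm : StrictMono m := strictMono_nat_of_lt_succ fun j => hf (m j + 1)
  have hanti : Antitone D := fun q q' hq z hz => by
    simp only [D, L, Set.mem_iInter, Set.mem_Iic, Set.mem_ofPred_eq] at hz ⊢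
    exact fun K hK t ht => hz K (hK.trans hq) t
      ⟨ht.1.trans hq, fun i hi => (ht.2 i hi).trans_le hq⟩
  have hlt : ∀ {i j}, i < j → m j ∈ D (m i + 1) := fun {i j} hij => by
    obtain ⟨j, rfl⟩ : ∃ j', j = j' + 1 := ⟨j - 1, by omega⟩
    exact hanti (Nat.succ_le_succ (hm.monotone (Nat.le_of_lt_succ hij))) (hfD (m j + 1))
  have hself : ∀ j, m j ∈ D j := fun j => by
    cases j with
    | zero => exact hfD 0
    | succ j => exact hanti (Nat.succ_le_succ hm.le_apply) (hlt j.lt_succ_self)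
  have hmem : ∀ {z q K t}, z ∈ D q → K ≤ q → t ∈ L q → z ∈ A K t := fun hz hK ht =>
    Set.mem_iInter₂.1 (Set.mem_iInter₂.1 hz _ hK) _ ht
  refine ⟨m, hm, fun K φ hφ hK k => ?_⟩
  cases k with
  | zero => exact hmem (hself (φ 0)) hK (by simp [L])
  | succ k =>
    have hk : k ≤ φ k := hφ.le_apply
    have hmk : φ k ≤ m (φ k) := hm.le_apply
    have h0k : φ 0 ≤ φ k := hφ.monotone k.zero_le
    refine hmem (hlt (hφ k.lt_succ_self)) (by omega) ⟨by simp; omega, fun i hi => ?_⟩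
    obtain ⟨l, hl, rfl⟩ := List.mem_map.1 hi
    exact Nat.lt_succ_of_le
      ((hm.comp hφ).monotone (Nat.le_of_lt_succ (List.mem_range.1 hl)))

/-- A dichotomy for closed properties of sequences, the `K`-th one being the conjunction of the
conditions `R K · k`, which depend only on the first `k` terms: along some sequence either one of
them holds for all subsequences, or all of them fail for all subsequences up to finitely many
terms. -/
theorem exists_forall_subseq_or_forall_not (R : ℕ → (ℕ → ℕ) → ℕ → Prop)
    (hR : ∀ K n n' k, (∀ i < k, n i = n' i) → R K n k → R K n' k) :
    (∃ K m, StrictMono m ∧ ∀ φ : ℕ → ℕ, StrictMono φ → ∀ k, R K (m ∘ φ) k) ∨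
    (∃ m : ℕ → ℕ, StrictMono m ∧
      ∀ K (φ : ℕ → ℕ), StrictMono φ → K ≤ φ 0 → ∃ k, ¬ R K (m ∘ φ) k) := by
  let U : Ultrafilter ℕ := Ultrafilter.of atTop
  have hU : (U : Filter ℕ) ≤ atTop := Ultrafilter.of_le atTop
  let F : ℕ → Set (List ℕ) := fun K => {s | ∃ n k, initialTerms n k = s ∧ ¬ R K n k}
  have hF : ∀ K n k, initialTerms n k ∈ F K ↔ ¬ R K n k := fun K n k => by
    refine ⟨?_, fun h => ⟨n, k, rfl, h⟩⟩
    rintro ⟨n', k', h, hn'⟩ hn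
    obtain ⟨rfl, heq⟩ := eq_of_initialTerms_eq h
    exact hn' (hR K n n' _ (fun i hi => (heq i hi).symm) hn)
  by_cases h : ∃ K, ∃ A : List ℕ → Set ℕ, (∀ t, A t ∈ U) ∧
      ∀ n, Follows n A → ∀ k, initialTerms n k ∉ F K
  · obtain ⟨K, A, hA, hn⟩ := h
    obtain ⟨m, hm, hmA⟩ := exists_strictMono_follows hU (fun _ => A) fun _ => hA
    exact Or.inl ⟨K, m, hm, fun φ hφ k => by
      simpa [hF] using hn _ (hmA 0 φ hφ (Nat.zero_le _)) k⟩
  · have h' := fun K => (exists_tree_avoids_or_meets U (F K)).resolve_left (not_exists.1 h K)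
    choose A hA hn using h'
    obtain ⟨m, hm, hmA⟩ := exists_strictMono_follows hU A hA
    exact Or.inr ⟨m, hm, fun K φ hφ hK => by
      simpa only [hF] using hn K _ (hmA K φ hφ hK)⟩

/-- Two interlaced sequences are the even and odd terms of a strictly increasing sequence. -/
theorem exists_strictMono_interlace {a b : ℕ → ℕ} (hab : ∀ k, a k < b k)
    (hba : ∀ k, b k < a (k + 1)) :
    ∃ φ : ℕ → ℕ, StrictMono φ ∧ (∀ k, φ (2 * k) = a k) ∧ ∀ k, φ (2 * k + 1) = b k := by
  have h1 : ∀ k, (2 * k + 1) / 2 = k := fun k => by omega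
  refine ⟨fun i => if Even i then a (i / 2) else b (i / 2), strictMono_nat_of_lt_succ fun i => ?_,
    fun k => by simp, fun k => by simp [h1]⟩
  obtain ⟨k, rfl | rfl⟩ := i.even_or_odd'
  · simpa [h1, Nat.even_add_one] using hab k
  · have h2 : (2 * k + 1 + 1) / 2 = k + 1 := by omega
    simpa [h1, h2, Nat.even_add_one] using hba k

/-- Each new index is chosen beyond the last value of `q`; since `k ≤ p k`, the next value of `p`
lies there too. -/
theorem exists_strictMono_interlace_of_frequently {p q : ℕ → ℕ} (hp : StrictMono p)
    (h : ∃ᶠ k in atTop, p k < q k) :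
    ∃ ψ φ : ℕ → ℕ, StrictMono ψ ∧ StrictMono φ ∧ (∀ k, φ (2 * k) = p (ψ k)) ∧
      ∀ k, φ (2 * k + 1) = q (ψ k) := by
  choose g hg hgpq using frequently_atTop.1 h
  let ψ : ℕ → ℕ := fun j => Nat.rec (g 0) (fun _ r => g (q r + 1)) j
  have hψ : ∀ k, p (ψ k) < q (ψ k) := fun k => by cases k <;> exact hgpq _
  have hψ' : ∀ k, q (ψ k) < ψ (k + 1) := fun k => hg (q (ψ k) + 1)
  obtain ⟨φ, hφ, h0, h1⟩ := exists_strictMono_interlace hψ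
    fun k => (hψ' k).trans_le hp.le_apply
  exact ⟨ψ, φ, strictMono_nat_of_lt_succ fun k =>
    (hp.le_apply.trans_lt (hψ k)).trans (hψ' k), hφ, h0, h1⟩

end Ramsey

/-! ### Equivalence as two-sided domination, and the interlacing dichotomy. -/

section Equivalence

variable {E F G : Type*} [NormedAddCommGroup E] [NormedSpace ℝ E]
  [NormedAddCommGroup F] [NormedSpace ℝ F] [NormedAddCommGroup G] [NormedSpace ℝ G]

/-- The sequence `x` is dominated by `y` with constant `C` on finite linear combinations. -/
def Dominated (C : ℝ) (x : ℕ → E) (y : ℕ → F) : Prop :=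
  ∀ f : ℕ →₀ ℝ, ‖Finsupp.linearCombination ℝ x f‖ ≤ C * ‖Finsupp.linearCombination ℝ y f‖

/-- No injectivity is needed: `mapDomain` adds up coefficients that share an image. -/
theorem Dominated.comp {C : ℝ} {x : ℕ → E} {y : ℕ → F} (h : Dominated C x y) (φ : ℕ → ℕ) :
    Dominated C (x ∘ φ) (y ∘ φ) := fun f => by
  simpa only [Finsupp.linearCombination_mapDomain] using h (f.mapDomain φ)

theorem Dominated.mono {C C' : ℝ} {x : ℕ → E} {y : ℕ → F} (h : Dominated C x y) (hC : C ≤ C') :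
    Dominated C' x y := fun f =>
  (h f).trans (mul_le_mul_of_nonneg_right hC (norm_nonneg _))

theorem Dominated.trans {C D : ℝ} {x : ℕ → E} {y : ℕ → F} {z : ℕ → G} (h : Dominated C x y)
    (h' : Dominated D y z) (hC : 0 ≤ C) : Dominated (C * D) x z := fun f => by
  rw [mul_assoc]
  exact (h f).trans (mul_le_mul_of_nonneg_left (h' f) hC)

theorem linearCombination_sum_single (a : ℕ → ℝ) (x : ℕ → E) (s : Finset ℕ) :
    Finsupp.linearCombination ℝ x (∑ n ∈ s, Finsupp.single n (a n)) = ∑ n ∈ s, a n • x n := by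
  simp

theorem Dominated.exists_seriesConvergesTo [CompleteSpace E] {C : ℝ} {x : ℕ → E} {y : ℕ → F}
    (h : Dominated C x y) (hC : 0 < C) {a : ℕ → ℝ} {t : F} (ht : SeriesConvergesTo a y t) :
    ∃ s, SeriesConvergesTo a x s := by
  refine cauchySeq_tendsto_of_complete (Metric.cauchySeq_iff'.2 fun ε hε => ?_)
  obtain ⟨N, hN⟩ := Metric.cauchySeq_iff'.1 (Tendsto.cauchySeq ht) (ε / C) (div_pos hε hC)
  refine ⟨N, fun n hn => ?_⟩
  have h1 := hN n hn
  have h2 := h (∑ i ∈ Finset.Ico N n, Finsupp.single i (a i))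
  rw [linearCombination_sum_single, linearCombination_sum_single] at h2
  rw [dist_eq_norm, ← Finset.sum_Ico_eq_sub _ hn] at h1 ⊢
  rw [lt_div_iff₀' hC] at h1
  exact h2.trans_lt h1

theorem Dominated.norm_le {C : ℝ} {x : ℕ → E} {y : ℕ → F} (h : Dominated C x y)
    {a : ℕ → ℝ} {s : E} {t : F} (hs : SeriesConvergesTo a x s) (ht : SeriesConvergesTo a y t) :
    ‖s‖ ≤ C * ‖t‖ :=
  le_of_tendsto_of_tendsto' hs.norm (ht.norm.const_mul C) fun N => by
    simpa only [linearCombination_sum_single] using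
      h (∑ i ∈ Finset.range N, Finsupp.single i (a i))

theorem seriesConvergesTo_linearCombination (f : ℕ →₀ ℝ) (x : ℕ → E) :
    SeriesConvergesTo f x (Finsupp.linearCombination ℝ x f) := by
  rw [Finsupp.linearCombination_apply, Finsupp.sum]
  exact (hasSum_sum_of_ne_finset_zero (fun n hn => by
    simp [Finsupp.notMem_support_iff.1 hn])).tendsto_sum_nat

theorem EquivWith.dominated {C : ℝ} {x : ℕ → E} {y : ℕ → F} (hC : 0 < C) (h : EquivWith C x y) :
    Dominated C x y ∧ Dominated C y x := by
  have h' := fun f : ℕ →₀ ℝ => (h f).2 _ _ (seriesConvergesTo_linearCombination f x)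
    (seriesConvergesTo_linearCombination f y)
  exact ⟨fun f => (h' f).2, fun f => (inv_mul_le_iff₀ hC).1 (h' f).1⟩

/-- In Banach spaces, equivalence of sequences means domination on finite linear combinations in
both directions. -/
theorem seqEquiv_iff_dominated [CompleteSpace E] [CompleteSpace F] {x : ℕ → E} {y : ℕ → F} :
    SeqEquiv x y ↔ ∃ C : ℝ, 0 < C ∧ Dominated C x y ∧ Dominated C y x := by
  constructor
  · rintro ⟨C, hC, h⟩
    exact ⟨C, hC, h.dominated hC⟩
  · rintro ⟨C, hC, h, h'⟩
    exact ⟨C, hC, fun a => ⟨⟨fun ⟨_, hs⟩ => h'.exists_seriesConvergesTo hC hs,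
      fun ⟨_, ht⟩ => h.exists_seriesConvergesTo hC ht⟩,
      fun s t hs ht => ⟨(inv_mul_le_iff₀ hC).2 (h'.norm_le ht hs), h.norm_le hs ht⟩⟩⟩

variable [CompleteSpace E] [CompleteSpace F] [CompleteSpace G]

theorem SeqEquiv.symm {x : ℕ → E} {y : ℕ → F} (h : SeqEquiv x y) : SeqEquiv y x := by
  obtain ⟨C, hC, h, h'⟩ := seqEquiv_iff_dominated.1 h
  exact seqEquiv_iff_dominated.2 ⟨C, hC, h', h⟩

theorem SeqEquiv.trans {x : ℕ → E} {y : ℕ → F} {z : ℕ → G} (h : SeqEquiv x y)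
    (h' : SeqEquiv y z) : SeqEquiv x z := by
  obtain ⟨C, hC, h1, h2⟩ := seqEquiv_iff_dominated.1 h
  obtain ⟨D, hD, h3, h4⟩ := seqEquiv_iff_dominated.1 h'
  exact seqEquiv_iff_dominated.2 ⟨C * D, mul_pos hC hD, h1.trans h3 hC.le,
    mul_comm D C ▸ h4.trans h2 hD.le⟩

theorem SeqEquiv.comp {x : ℕ → E} {y : ℕ → F} (h : SeqEquiv x y) (φ : ℕ → ℕ) :
    SeqEquiv (x ∘ φ) (y ∘ φ) := by
  obtain ⟨C, hC, h, h'⟩ := seqEquiv_iff_dominated.1 h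
  exact seqEquiv_iff_dominated.2 ⟨C, hC, h.comp φ, h'.comp φ⟩

/-- Either two sequences have equivalent subsequences along the same indices, or along some index
sequence no interlaced subsequences of them are equivalent. -/
theorem exists_seqEquiv_subseq_or_forall_interlaced_not (x : ℕ → E) (y : ℕ → F) :
    (∃ n : ℕ → ℕ, StrictMono n ∧ SeqEquiv (x ∘ n) (y ∘ n)) ∨
    (∃ m : ℕ → ℕ, StrictMono m ∧ ∀ φ : ℕ → ℕ, StrictMono φ →
      ¬ SeqEquiv (fun k => x (m (φ (2 * k)))) (fun k => y (m (φ (2 * k + 1))))) := by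
  let R : ℕ → (ℕ → ℕ) → ℕ → Prop := fun K n k =>
    ∀ f : ℕ →₀ ℝ, (∀ i ∈ f.support, 2 * i + 1 < k) →
      ‖Finsupp.linearCombination ℝ (fun k => x (n (2 * k))) f‖ ≤
        (K + 1) * ‖Finsupp.linearCombination ℝ (fun k => y (n (2 * k + 1))) f‖ ∧
      ‖Finsupp.linearCombination ℝ (fun k => y (n (2 * k + 1))) f‖ ≤
        (K + 1) * ‖Finsupp.linearCombination ℝ (fun k => x (n (2 * k))) f‖
  have hR : ∀ K n n' k, (∀ i < k, n i = n' i) → R K n k → R K n' k := fun K n n' k h hn f hf => by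
    have hx : Finsupp.linearCombination ℝ (fun k => x (n (2 * k))) f =
        Finsupp.linearCombination ℝ (fun k => x (n' (2 * k))) f :=
      Finset.sum_congr rfl fun i hi => by
        have := hf i hi
        simp [h (2 * i) (by omega)]
    have hy : Finsupp.linearCombination ℝ (fun k => y (n (2 * k + 1))) f =
        Finsupp.linearCombination ℝ (fun k => y (n' (2 * k + 1))) f :=
      Finset.sum_congr rfl fun i hi => by simp [h (2 * i + 1) (hf i hi)]
    simpa only [hx, hy] using hn f hf
  rcases exists_forall_subseq_or_forall_not R hR with ⟨K, m, hm, h⟩ | ⟨m, hm, h⟩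
  · left
    have key : ∀ a b : ℕ → ℕ, (∀ k, a k < b k) → (∀ k, b k < a (k + 1)) →
        SeqEquiv (fun k => x (m (a k))) (fun k => y (m (b k))) := fun a b hab hba => by
      obtain ⟨φ, hφ, h0, h1⟩ := exists_strictMono_interlace hab hba
      have h' : ∀ f : ℕ →₀ ℝ, _ := fun f =>
        h φ hφ (2 * f.support.sup id + 2) f fun i hi => by
          have : i ≤ f.support.sup id := Finset.le_sup (f := id) hi
          omega
      simp only [Function.comp_apply, h0, h1] at h'
      exact seqEquiv_iff_dominated.2 ⟨K + 1, by positivity, fun f => (h' f).1, fun f => (h' f).2⟩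
    -- The chain is x(4k+4) ~ y(4k+5) ~ x(4k+3) ~ y(4k+4), each link being interlaced.
    refine ⟨fun k => m (4 * k + 4), fun i j hij => hm (by omega), ?_⟩
    have h1 := key (fun k => 4 * k + 4) (fun k => 4 * k + 5) (by intro; omega) (by intro; omega)
    have h2 := key (fun k => 4 * k + 3) (fun k => 4 * k + 5) (by intro; omega) (by intro; omega)
    have h3 := key (fun k => 4 * k + 3) (fun k => 4 * k + 4) (by intro; omega) (by intro; omega)
    exact (h1.trans h2.symm).trans h3
  · refine Or.inr ⟨m, hm, fun φ hφ he => ?_⟩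
    obtain ⟨C, hC, h1, h2⟩ := seqEquiv_iff_dominated.1 he
    obtain ⟨K, hK⟩ := exists_nat_ge C
    -- Dropping `2 * K` terms makes the sequence start beyond `K`; the even shift preserves parity.
    have hshift : StrictMono fun i => φ (i + 2 * K) := fun i j hij => hφ (by omega)
    have hle : K ≤ φ (0 + 2 * K) := le_trans (by omega) hφ.le_apply
    obtain ⟨k, hk⟩ := h K _ hshift hle
    have hK' : C ≤ K + 1 := by linarith
    have e : ∀ i, 2 * (i + K) = 2 * i + 2 * K := fun i => by ring
    refine hk fun f _ => ⟨?_, ?_⟩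
    · simpa only [Function.comp_def, e, Nat.add_right_comm _ (2 * K) 1] using (h1.mono hK').comp (fun i => i + K) f
    · simpa only [Function.comp_def, e, Nat.add_right_comm _ (2 * K) 1] using (h2.mono hK').comp (fun i => i + K) f

end Equivalence

/-! ### Comparison of DH and quasi-DH. -/

theorem IsNormalizedDisjoint.comp {E : Type*} [NormedAddCommGroup E] [Lattice E] {x : ℕ → E}
    (hx : IsNormalizedDisjoint x) {n : ℕ → ℕ} (hn : StrictMono n) :
    IsNormalizedDisjoint (x ∘ n) :=
  ⟨fun k => hx.1 (n k), fun i j hij => hx.2 (n i) (n j) (hn.injective.ne hij)⟩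

theorem IsDH.isQuasiDH {E : Type*} [NormedAddCommGroup E] [NormedSpace ℝ E] [Lattice E]
    (h : IsDH E) : IsQuasiDH E := fun x y hx hy =>
  let ⟨n, hn, he⟩ := h x y hx hy
  ⟨n, n, hn, hn, he⟩

theorem IsQuasiDH.isDH {E : Type*} [NormedAddCommGroup E] [NormedSpace ℝ E] [CompleteSpace E]
    [Lattice E] (h : IsQuasiDH E) : IsDH E := by
  intro x y hx hy
  rcases exists_seqEquiv_subseq_or_forall_interlaced_not x y with h1 | ⟨m, hm, h1⟩
  · exact h1
  -- The roles are swapped to cover the case where the `y` index comes first.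
  rcases exists_seqEquiv_subseq_or_forall_interlaced_not (y ∘ m) (x ∘ m) with
    ⟨n, hn, h2⟩ | ⟨l, hl, h2⟩
  · exact ⟨m ∘ n, hm.comp hn, h2.symm⟩
  have hml := hm.comp hl
  obtain ⟨p, q, hp, hq, he⟩ := h _ _ (hx.comp hml) (hy.comp hml)
  have hf : (∃ᶠ k in atTop, p k < q k) ∨ (∃ᶠ k in atTop, p k = q k) ∨
      ∃ᶠ k in atTop, q k < p k := by
    rw [← frequently_or_distrib, ← frequently_or_distrib]
    exact Frequently.of_forall fun k => lt_trichotomy _ _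
  rcases hf with hf | hf | hf
  · obtain ⟨ψ, φ, -, hφ, h0, h3⟩ := exists_strictMono_interlace_of_frequently hp hf
    refine absurd (he.comp ψ) ?_
    simpa only [Function.comp_def, h0, h3] using h1 (l ∘ φ) (hl.comp hφ)
  · obtain ⟨ψ, hψ, heq⟩ := extraction_of_frequently_atTop hf
    refine ⟨m ∘ l ∘ p ∘ ψ, hml.comp (hp.comp hψ), ?_⟩
    have := he.comp ψ
    simpa only [Function.comp_def, heq] using this
  · obtain ⟨ψ, φ, -, hφ, h0, h3⟩ := exists_strictMono_interlace_of_frequently hq hf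
    refine absurd (he.comp ψ).symm ?_
    simpa only [Function.comp_def, h0, h3] using h2 φ hφ

end BanachLattice

theorem mainTheorem1 (E : Type*) [NormedAddCommGroup E] [NormedSpace ℝ E] [CompleteSpace E]
    [Lattice E] [IsOrderedAddMonoid E] [IsOrderedModule ℝ E] [HasSolidNorm E] :
    BanachLattice.IsDH E ↔ BanachLattice.IsQuasiDH E :=
  ⟨BanachLattice.IsDH.isQuasiDH, BanachLattice.IsQuasiDH.isDH⟩
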